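/- Let $M$ be a matroid on a finite set $E$ with a fixed linear order $<$ on $E$. For $S\subseteq E$, let $\operatorname{EA}(S)$ be the set of $e\in E\setminus S$ that are the maximum of some circuit of $M$ contained in $S\cup\{e\}$, and let $\operatorname{IA}(S)$ be the set of $i\in S$ that are the maximum of some circuit of the dual matroid $M^\perp$ contained in $(E\setminus S)\cup\{i\}$. By a theorem of Crapo every independent set $I$ can be written as $I=B\setminus Y$ with $Y\subseteq\operatorname{IA}(B)$ for a unique basis $B=B_I$; two independent sets $I,J$ are called related if $B_I=B_J$. The order $\leq_{ext/int}$ on independent sets is defined as follows: if $I$ and $J$ are related, then $I\leq_{ext/int}J$ means $I\subseteq J$; if they are not related, it means $(I\setminus\operatorname{IA}(I))\cup\operatorname{EA}(I)\subseteq (J\setminus\operatorname{IA}(J))\cup\operatorname{EA}(J)$. A broken circuit is a circuit with its maximum deleted, and $\mathrm{NBC}(M)$ is the simplicial complex of all subsets of $E$ (the nbc sets) that contain no broken circuit. The augmented nbc complex $\Delta^{\mathrm{nbc}}_M$ is the simplicial complex on $\{y_e,z_e : e\in E\}$ with facets $G(I)=\{y_e : e\in B_I\setminus I\}\cup\{z_e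 : e\in I\}$, one for each nbc set $I$. A listing $F_1,\dots,F_s$ (without repetition) of the facets of a pure simplicial complex $\Delta$ is a shelling if for all $i<k$ there are $j<k$ and $e\in F_k$ with $F_i\cap F_k\subseteq F_j\cap F_k=F_k\setminus\{e\}$. Its restriction sets $R_j\subseteq F_j$ are determined by: for all $A\subseteq F_j$, $R_j\subseteq A$ if and only if $A\not\subseteq F_i$ for every $i<j$. For a face $G$ of $\Delta$ put $R(G)=R_i$ for the unique $i$ with $R_i\subseteq G\subseteq F_i$. The shelling has property (H) if, for every face $G$, every facet $F\supseteq G$ and every $e\in G$ with $e\in R(F)$, one has $e\in R(G)$; it is then called an H-shelling. A shelling whose restriction sets form a simplicial complex $\Gamma$ is an h-shelling, with h-complex $\Gamma$. **Corollary.** Let $I_1,\dots,I_s$ be a listing of all nbc sets of $M$ in the order of any linear extension of the restriction of $\leq_{ext/int}$ to $\mathrm{NBC}(M)$. Then $G(I_1),\dots,G(I_s)$ is a shelling of $\Delta^{\mathrm{nbc}}_M$ (in particular this complex is pure with exactly these facets, which are distinct), and this shelling has property (H), so it is an H-shelling. Moreover it is an h-shelling whose h-complex is $\mathrm{NBC}(M)$,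 where $e\in E$ is identified with $z_e$: the restriction sets are exactly the sets $\{z_e : e\in S\}$ with $S\in\mathrm{NBC}(M)$. -/

import Mathlib

open Set

namespace AugNbc

universe u v

/-! ### Finite simplicial complexes and shellings -/

/-- A finite simplicial complex on a finite ground set. The empty set may be a face, elements of the
ground set need not be vertices, and the void complex (no faces at all) is allowed. -/
structure FinComplex (V : Type u) where
  ground : Set V
  ground_finite : ground.Finite
  faces : Set (Set V)
  subset_ground : ∀ A ∈ faces, A ⊆ ground
  down_closed : ∀ A ∈ faces, ∀ A' ⊆ A, A' ∈ faces

namespace FinComplex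

variable {V : Type u} {W : Type v}

/-- The facets: faces that are maximal under inclusion. -/
def facets (Δ : FinComplex V) : Set (Set V) :=
  {A | Maximal (fun A' => A' ∈ Δ.faces) A}

/-- All facets have the same cardinality. -/
def IsPure (Δ : FinComplex V) : Prop :=
  ∀ A ∈ Δ.facets, ∀ A' ∈ Δ.facets, A.ncard = A'.ncard

/-- The complex on the given ground set generated by a family of subsets. -/
def generatedBy (ground : Set V) (hfin : ground.Finite) (𝓕 : Set (Set V))
    (h𝓕 : ∀ A ∈ 𝓕, A ⊆ ground) : FinComplex V where
  ground := ground
  ground_finite := hfin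
  faces := {A | ∃ F ∈ 𝓕, A ⊆ F}
  subset_ground := by
    rintro A ⟨F, hF, hA⟩
    exact hA.trans (h𝓕 F hF)
  down_closed := by
    rintro A ⟨F, hF, hA⟩ A' hA'
    exact ⟨F, hF, hA'.trans hA⟩

/-- The copy of a complex obtained by renaming its elements along `f`. -/
def map (f : V → W) (Δ : FinComplex V) : FinComplex W where
  ground := f '' Δ.ground
  ground_finite := Δ.ground_finite.image f
  faces := (fun A => f '' A) '' Δ.faces
  subset_ground := by
    rintro _ ⟨A, hA, rfl⟩
    exact image_mono (Δ.subset_ground A hA)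
  down_closed := by
    rintro _ ⟨A, hA, rfl⟩ A' hA'
    obtain ⟨A'', h, rfl⟩ := subset_image_iff.1 hA'
    exact ⟨A'', Δ.down_closed A hA A'' h, rfl⟩

/-- `F 0, F 1, …` lists the facets of the pure complex `Δ`, without repetition, in a shelling
order. -/
structure IsShelling (Δ : FinComplex V) {s : ℕ} (F : Fin s → Set V) : Prop where
  pure : Δ.IsPure
  injective : Function.Injective F
  range_eq : range F = Δ.facets
  shelling : ∀ i k, i < k → ∃ j, j < k ∧ ∃ e ∈ F k,
    F i ∩ F k ⊆ F j ∩ F k ∧ F j ∩ F k = F k \ {e}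

end FinComplex

section Restriction

variable {V : Type u} {s : ℕ}

/-- The faces that are new when `F j` is added to the complex generated by its predecessors. -/
def newFaces (F : Fin s → Set V) (j : Fin s) : Set (Set V) :=
  {A | A ⊆ F j ∧ ∀ i, i < j → ¬ A ⊆ F i}

/-- The restriction set `R j` of `F j`: the smallest new face. For a shelling, the new faces are
exactly those of the interval `[R j, F j]`, see `FinComplex.IsShelling.newFaces_eq_Icc`. -/
def restrictionSet (F : Fin s → Set V) (j : Fin s) : Set V :=
  ⋂₀ newFaces F j

/-- Property (H): if `e ∈ G ⊆ F j` and `e ∈ R(F j)`, then `e ∈ R(G)`. Here `R(G)` is `R i` for the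
index `i` with `G ∈ [R i, F i]`; for a face of a shelled complex there is exactly one such
index, see `FinComplex.IsShelling.existsUnique_mem_Icc`. -/
def PropertyH (F : Fin s → Set V) : Prop :=
  ∀ (G : Set V) (i j : Fin s) (e : V), G ∈ Icc (restrictionSet F i) (F i) → G ⊆ F j →
    e ∈ G → e ∈ restrictionSet F j → e ∈ restrictionSet F i

/-- An H-shelling is a shelling with property (H). -/
structure IsHShelling (Δ : FinComplex V) (F : Fin s → Set V) : Prop where
  isShelling : Δ.IsShelling F
  propertyH : PropertyH F

/-- The restriction sets of `F` are precisely the faces of the simplicial complex `Γ`. When `F` is a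
shelling, this says that it is an h-shelling with h-complex `Γ`. -/
def HasHComplex (F : Fin s → Set V) (Γ : FinComplex V) : Prop :=
  range (restrictionSet F) = Γ.faces

theorem FinComplex.IsShelling.newFaces_eq_Icc {Δ : FinComplex V} {F : Fin s → Set V}
    (h : Δ.IsShelling F) (k : Fin s) :
    newFaces F k = Icc (restrictionSet F k) (F k) := by
  set R : Set V := {e | e ∈ F k ∧ ∃ j, j < k ∧ F j ∩ F k = F k \ {e}} with hR
  have hnew : newFaces F k = Icc R (F k) := by
    ext A
    constructor
    · rintro ⟨hA, hn⟩
      refine ⟨fun e he => ?_, hA⟩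
      obtain ⟨-, j, hj, hjk⟩ := he
      by_contra heA
      refine hn j hj fun x hx => ?_
      have hx' : x ∈ F j ∩ F k := by
        rw [hjk]
        exact ⟨hA hx, fun hxe => heA (hxe ▸ hx)⟩
      exact hx'.1
    · rintro ⟨hRA, hA⟩
      refine ⟨hA, fun i hi hAi => ?_⟩
      obtain ⟨j, hj, e, he, hsub, heq⟩ := h.shelling i k hi
      have heA : e ∈ A := hRA ⟨he, j, hj, heq⟩
      have : e ∈ F k \ {e} := heq ▸ hsub ⟨hAi heA, hA heA⟩
      exact this.2 rfl
  have hres : restrictionSet F k = R := by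
    rw [restrictionSet, hnew]
    refine Subset.antisymm (sInter_subset_of_mem ⟨Subset.rfl, fun e he => he.1⟩) ?_
    exact subset_sInter fun A hA => hA.1
  rw [hres, hnew]

theorem FinComplex.IsShelling.existsUnique_mem_Icc {Δ : FinComplex V} {F : Fin s → Set V}
    (h : Δ.IsShelling F) {G : Set V} (hG : G ∈ Δ.faces) :
    ∃! i, G ∈ Icc (restrictionSet F i) (F i) := by
  simp only [← h.newFaces_eq_Icc]
  have hfin : Δ.faces.Finite := Δ.ground_finite.finite_subsets.subset Δ.subset_ground
  obtain ⟨A, hGA, hA⟩ := hfin.exists_le_maximal hG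
  have hA' : A ∈ range F := h.range_eq ▸ hA
  obtain ⟨j, rfl⟩ := hA'
  obtain ⟨i, hi⟩ := (toFinite {i | G ⊆ F i}).exists_minimal ⟨j, hGA⟩
  refine ⟨i, ⟨hi.prop, fun l hl hGl => not_lt_of_ge (hi.le_of_le hGl hl.le) hl⟩, ?_⟩
  rintro l ⟨hl, hl'⟩
  rcases lt_trichotomy l i with hlt | heq | hgt
  · exact absurd hlt (not_lt_of_ge (hi.le_of_le hl hlt.le))
  · exact heq
  · exact absurd hi.prop (hl' i hgt)

end Restriction

/-! ### Matroid activities -/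

section Activities

variable {α : Type u} [LinearOrder α]

/-- Externally active elements with respect to `S`. -/
def EA (M : Matroid α) (S : Set α) : Set α :=
  {e | e ∈ M.E \ S ∧ ∃ γ, M.IsCircuit γ ∧ γ ⊆ insert e S ∧ IsGreatest γ e}

/-- Internally active elements of `S`: externally active for `E \ S` in the dual matroid. -/
def IA (M : Matroid α) (S : Set α) : Set α :=
  {i | i ∈ S ∧ i ∈ EA M✶ (M.E \ S)}

/-- The independent set `I` is related to the basis `B`: `I = B \ Y` for some `Y ⊆ IA(B)`. -/
def RelatedToBase (M : Matroid α) (I B : Set α) : Prop :=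
  M.IsBase B ∧ ∃ Y, Y ⊆ IA M B ∧ I = B \ Y

/-- `I` and `J` are internally related: they are related to a common basis. -/
def InternallyRelated (M : Matroid α) (I J : Set α) : Prop :=
  ∃ B, RelatedToBase M I B ∧ RelatedToBase M J B

/-- The external/internal order on independent sets. -/
def ExtIntLE (M : Matroid α) (I J : Set α) : Prop :=
  (¬ InternallyRelated M I J ∧ (I \ IA M I) ∪ EA M I ⊆ (J \ IA M J) ∪ EA M J) ∨
    (InternallyRelated M I J ∧ I ⊆ J)

open Classical in
/-- The basis to which `I` is related. By a theorem of Crapo every independent set is related to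
exactly one basis; for other sets the value is irrelevant. -/
noncomputable def relatedBase (M : Matroid α) (I : Set α) : Set α :=
  if h : ∃ B, RelatedToBase M I B then h.choose else I

/-! ### The nbc complex and the augmented nbc complex -/

/-- A broken circuit is a circuit with its maximum element deleted. -/
def IsBrokenCircuit (M : Matroid α) (D : Set α) : Prop :=
  ∃ γ e, M.IsCircuit γ ∧ IsGreatest γ e ∧ D = γ \ {e}

/-- The no broken circuit complex `NBC(M)`. -/
def nbcComplex (M : Matroid α) [M.Finite] : FinComplex α where
  ground := M.E
  ground_finite := M.ground_finite
  faces := {S | S ⊆ M.E ∧ ∀ D, IsBrokenCircuit M D → ¬ D ⊆ S}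
  subset_ground := fun _ hA => hA.1
  down_closed := fun _ hA _ hA' =>
    ⟨hA'.trans hA.1, fun D hD hDA => hA.2 D hD (hDA.trans hA')⟩

/-- The elements `y_e` and `z_e` for `e : α`. -/
inductive YZ (α : Type u) : Type u
  | y : α → YZ α
  | z : α → YZ α

/-- The set `y_S z_T = {y_e | e ∈ S} ∪ {z_e | e ∈ T}`. -/
def yz (S T : Set α) : Set (YZ α) :=
  YZ.y '' S ∪ YZ.z '' T

/-- The facet `G(I) = y_{B_I \ I} z_I`, where `B_I` is the basis related to `I`. -/
noncomputable def nbcFacet (M : Matroid α) (I : Set α) : Set (YZ α) :=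
  yz (relatedBase M I \ I) I

theorem nbcFacet_subset (M : Matroid α) {I : Set α} (hI : I ⊆ M.E) :
    nbcFacet M I ⊆ yz M.E M.E := by
  refine union_subset_union (image_mono ?_) (image_mono hI)
  refine sdiff_subset.trans ?_
  unfold relatedBase
  split_ifs with h
  · exact h.choose_spec.1.subset_ground
  · exact hI

/-- The augmented nbc complex on `E(y,z)`, generated by the sets `G(I)` for `I` an nbc set. -/
noncomputable def augNbcComplex (M : Matroid α) [M.Finite] : FinComplex (YZ α) :=
  FinComplex.generatedBy (yz M.E M.E)
    ((M.ground_finite.image _).union (M.ground_finite.image _))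
    (nbcFacet M '' (nbcComplex M).faces)
    (by
      rintro _ ⟨I, hI, rfl⟩
      exact nbcFacet_subset M hI.1)

/-- `I 0, I 1, …` lists all nbc sets, without repetition, in the order of a linear extension of the
external/internal order on `NBC(M)`. -/
structure IsLinearExtension (M : Matroid α) [M.Finite] {s : ℕ} (I : Fin s → Set α) : Prop where
  injective : Function.Injective I
  range_eq : range I = (nbcComplex M).faces
  monotone : ∀ i j, ExtIntLE M (I i) (I j) → i ≤ j

end Activities

end AugNbc

namespace AugNbc

universe u

section Vertices

variable {α : Type u}

/-! On nbc sets no element is externally active, and internal activity passes to subsets, so the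
external/internal order contains inclusion (`extIntLE_of_subset`). Any linear extension therefore
lists each `I \ {e}` before `I`. The matroid input is that shrinking `I` enlarges `B_I \ I`
(`RelatedToBase.sdiff_subset_sdiff`), so `G(I \ {e})` meets `G(I)` in exactly `G(I) \ {z_e}`. An
earlier `I_i` cannot contain `I_k`, so `G(I_i)` misses some `z_e` with `e ∈ I_k`: this gives the
shelling, with restriction sets `z_I`. Property (H) follows because `z_I` consists of all the
`z`-vertices of `G(I)`. -/

@[simp]
theorem y_mem_yz {S T : Set α} {e : α} : YZ.y e ∈ yz S T ↔ e ∈ S := by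
  simp [yz]

@[simp]
theorem z_mem_yz {S T : Set α} {e : α} : YZ.z e ∈ yz S T ↔ e ∈ T := by
  simp [yz]

theorem z_injective : Function.Injective (YZ.z : α → YZ α) := fun _ _ h => YZ.z.inj h

theorem y_injective : Function.Injective (YZ.y : α → YZ α) := fun _ _ h => YZ.y.inj h

theorem ncard_yz {S T : Set α} (hS : S.Finite) (hT : T.Finite) :
    (yz S T).ncard = S.ncard + T.ncard := by
  rw [yz, ncard_union_eq _ (hS.image _) (hT.image _), ncard_image_of_injective _ y_injective,
    ncard_image_of_injective _ z_injective]
  rw [Set.disjoint_left]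
  rintro _ ⟨x, -, rfl⟩ ⟨y, -, h⟩
  cases h

end Vertices

section Matroid

variable {α : Type u} {M : Matroid α}

/-- A circuit in `X ∪ {e}` through `e` would meet `K` in `e` alone, which is impossible for a
circuit and a cocircuit. -/
theorem notMem_closure_of_disjoint_isCocircuit {K X : Set α} {e : α} (hK : M.IsCocircuit K)
    (he : e ∈ K) (hX : Disjoint X K) : e ∉ M.closure X := by
  intro h
  have heX : e ∉ X := fun h' => hX.le_bot ⟨h', he⟩
  obtain ⟨C, hC, hCi, heC⟩ := M.exists_isCircuit_of_mem_closure h heX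
  refine hCi.inter_isCocircuit_ne_singleton hK (e := e) ?_
  refine Subset.antisymm ?_ (singleton_subset_iff.2 ⟨heC, he⟩)
  rintro x ⟨hxC, hxK⟩
  rcases hC hxC with h' | h'
  · exact h'
  · exact (hX.le_bot ⟨h', hxK⟩).elim

end Matroid

/-! ### Internal activity and the bases related to an independent set -/

section Activities

variable {α : Type u} [LinearOrder α] {M : Matroid α}

/-- The cocircuit witnessing activity meets `S` only in `i` and has nothing above `i`. -/
theorem notMem_closure_of_mem_IA {S : Set α} {i : α} (hi : i ∈ IA M S) :
    i ∉ M.closure (S \ {i} ∪ Ioi i) := by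
  obtain ⟨-, -, K, hK, hKS, hiK, hmax⟩ := hi
  refine notMem_closure_of_disjoint_isCocircuit (M.isCocircuit_def.2 hK) hiK ?_
  rw [Set.disjoint_left]
  rintro x (⟨hxS, hxi⟩ | hx) hxK
  · rcases hKS hxK with h | h
    · exact hxi h
    · exact h.2 hxS
  · exact (hmax hxK).not_gt hx

theorem mem_IA_of_subset {I J : Set α} {i : α} (hIJ : I ⊆ J) (hI : i ∈ I)
    (hi : i ∈ IA M J) : i ∈ IA M I := by
  obtain ⟨hiJ, ⟨hiE, -⟩, K, hK, hKS, hmax⟩ := hi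
  refine ⟨hI, ⟨hiE, fun h => h.2 hI⟩, K, hK, hKS.trans (insert_subset_insert ?_), hmax⟩
  exact sdiff_subset_sdiff_right hIJ

/-- The witness is the fundamental cocircuit of `y`; the hypothesis says that it has no element
above `y`. -/
theorem mem_IA_of_isBase {B : Set α} {y : α} (hB : M.IsBase B) (hy : y ∈ B)
    (hgt : ∀ x ∈ M.E, y < x → x ∈ M.closure (B \ {y})) : y ∈ IA M B := by
  have hyE : y ∈ M.E := hB.subset_ground hy
  refine ⟨hy, ⟨hyE, fun h => h.2 hy⟩, M.E \ M.closure (B \ {y}),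
    hB.compl_closure_sdiff_singleton_isCocircuit hy, ?_,
    ⟨hyE, hB.indep.notMem_closure_sdiff_of_mem hy⟩, ?_⟩
  · rintro x ⟨hxE, hx⟩
    by_cases hxy : x = y
    · exact Or.inl hxy
    · refine Or.inr ⟨hxE, fun hxB => hx ?_⟩
      exact M.mem_closure_of_mem' (X := B \ {y}) ⟨hxB, hxy⟩ hxE
  · rintro x ⟨hxE, hx⟩
    exact not_lt.1 fun h => hx (hgt x hxE h)

/-- The greedy completion of `I` by elements that are as large as possible. -/
def maxCompletion (M : Matroid α) (I : Set α) : Set α :=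
  I ∪ {y | y ∈ M.E ∧ y ∉ M.closure (I ∪ Ioi y)}

/-- Downward induction on `e`: either `e` itself was added, or it is spanned by `I` and larger
elements. -/
theorem mem_closure_maxCompletion [M.Finite] {I : Set α} {e : α} (he : e ∈ M.E) :
    e ∈ M.closure (I ∪ maxCompletion M I ∩ Ici e) := by
  have hwf : (M.E).WellFoundedOn (· > ·) := M.ground_finite.wellFoundedOn
  refine hwf.induction (P := fun e => e ∈ M.closure (I ∪ maxCompletion M I ∩ Ici e)) he
    fun e he ih => ?_
  by_cases h : e ∈ M.closure (I ∪ Ioi e)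
  · rw [← M.closure_inter_ground] at h
    refine M.closure_subset_closure_of_subset_closure ?_ h
    rintro x ⟨hx | hx, hxE⟩
    · exact M.mem_closure_of_mem' (Or.inl hx) hxE
    · refine M.closure_subset_closure ?_ (ih x hxE hx)
      exact union_subset_union_right _ (inter_subset_inter_right _ (Ici_subset_Ici.2 (le_of_lt hx)))
  · exact M.mem_closure_of_mem' (Or.inr ⟨Or.inr ⟨he, h⟩, le_rfl⟩) he

/-- In a circuit, the smallest element outside `I` would be spanned by `I` and larger elements,
contrary to its having been added. -/
theorem indep_maxCompletion [M.Finite] {I : Set α} (hI : M.Indep I) :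
    M.Indep (maxCompletion M I) := by
  have hE : maxCompletion M I ⊆ M.E := union_subset hI.subset_ground fun _ h => h.1
  rw [Matroid.indep_iff_forall_subset_not_isCircuit]
  intro C hC hCc
  have hne : (C \ I).Nonempty := by
    rw [sdiff_nonempty]
    exact fun h => hCc.not_indep (hI.subset h)
  have hfin : (C \ I).Finite := M.ground_finite.subset (sdiff_subset.trans (hC.trans hE))
  obtain ⟨y, ⟨hyC, hyI⟩, hmin⟩ := exists_min_image (C \ I) id hfin hne
  rcases hC hyC with h | h
  · exact hyI h
  refine h.2 (M.closure_subset_closure ?_ (hCc.mem_closure_sdiff_singleton_of_mem hyC))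
  rintro x ⟨hxC, hxy⟩
  by_cases hxI : x ∈ I
  · exact Or.inl hxI
  · exact Or.inr (lt_of_le_of_ne (hmin x ⟨hxC, hxI⟩) (Ne.symm hxy))

theorem isBase_maxCompletion [M.Finite] {I : Set α} (hI : M.Indep I) :
    M.IsBase (maxCompletion M I) := by
  refine (indep_maxCompletion hI).isBase_of_ground_subset_closure fun e he => ?_
  exact M.closure_subset_closure (union_subset subset_union_left inter_subset_left)
    (mem_closure_maxCompletion (I := I) he)

/-- The existence half of Crapo's theorem. -/
theorem relatedToBase_maxCompletion [M.Finite] {I : Set α} (hI : M.Indep I) :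
    RelatedToBase M I (maxCompletion M I) := by
  refine ⟨isBase_maxCompletion hI, maxCompletion M I \ I, ?_, ?_⟩
  · rintro y ⟨hy, hyI⟩
    refine mem_IA_of_isBase (isBase_maxCompletion hI) hy fun x hxE hyx => ?_
    -- The set spanning `x` consists of `I` and elements at least `x > y`, so it omits `y`.
    refine M.closure_subset_closure ?_ (mem_closure_maxCompletion (I := I) hxE)
    rintro b (hb | ⟨hb, hxb⟩)
    · exact ⟨Or.inl hb, fun h => hyI (h ▸ hb)⟩
    · exact ⟨hb, fun h => (hyx.trans_le hxb).ne' h⟩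
  · exact (sdiff_sdiff_cancel_left (s := I) (t := maxCompletion M I) subset_union_left).symm

theorem RelatedToBase.subset {I B : Set α} (h : RelatedToBase M I B) : I ⊆ B := by
  obtain ⟨-, Y, -, rfl⟩ := h
  exact sdiff_subset

theorem RelatedToBase.mem_IA {I B : Set α} (h : RelatedToBase M I B) {y : α} (hy : y ∈ B)
    (hyI : y ∉ I) : y ∈ IA M B := by
  obtain ⟨-, Y, hY, rfl⟩ := h
  by_contra h
  exact hyI ⟨hy, fun h' => h (hY h')⟩

/-- If `y ∉ B`, its fundamental circuit contains some `b ∈ B \ J` with `b < y`. Such a `b` is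
internally active, yet the circuit puts it in the closure of `B \ {b}` and the larger element `y`.
-/
theorem RelatedToBase.mem_of_notMem_closure {J B : Set α} (h : RelatedToBase M J B) {y : α}
    (hyE : y ∈ M.E) (hy : y ∉ M.closure (J ∪ Ioi y)) : y ∈ B := by
  by_contra hyB
  have hycl : y ∈ M.closure B := h.1.closure_eq ▸ hyE
  obtain ⟨C, hC, hCc, hyC⟩ := M.exists_isCircuit_of_mem_closure hycl hyB
  refine hy (M.closure_subset_closure ?_ (hCc.mem_closure_sdiff_singleton_of_mem hyC))
  rintro b ⟨hbC, hby⟩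
  by_contra hb
  rw [mem_union, not_or, mem_Ioi, not_lt] at hb
  have hbB : b ∈ B := (hC hbC).resolve_left hby
  refine notMem_closure_of_mem_IA (h.mem_IA hbB hb.1)
    (M.closure_subset_closure ?_ (hCc.mem_closure_sdiff_singleton_of_mem hbC))
  rintro x ⟨hxC, hxb⟩
  rcases hC hxC with rfl | hxB
  · exact Or.inr (lt_of_le_of_ne hb.2 hby)
  · exact Or.inl ⟨hxB, hxb⟩

/-- An active `y ∈ B \ I` is not spanned by `B \ {y}`, hence not by `J`, together with the elements
above `y`. The case `I = J` contains the uniqueness half of Crapo's theorem. -/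
theorem RelatedToBase.sdiff_subset_sdiff {I J B B' : Set α} (h : RelatedToBase M I B)
    (h' : RelatedToBase M J B') (hJI : J ⊆ I) : B \ I ⊆ B' \ J := by
  rintro y ⟨hyB, hyI⟩
  refine ⟨h'.mem_of_notMem_closure (h.1.subset_ground hyB) fun hy => ?_, fun hy => hyI (hJI hy)⟩
  refine notMem_closure_of_mem_IA (h.mem_IA hyB hyI) (M.closure_subset_closure ?_ hy)
  refine union_subset_union_left _ fun x hx => ⟨h.subset (hJI hx), ?_⟩
  exact fun hxy => hyI (hxy ▸ hJI hx)

theorem relatedToBase_relatedBase [M.Finite] {I : Set α} (hI : M.Indep I) :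
    RelatedToBase M I (relatedBase M I) := by
  have h : ∃ B, RelatedToBase M I B := ⟨_, relatedToBase_maxCompletion hI⟩
  rw [relatedBase, dif_pos h]
  exact h.choose_spec

/-! ### Nbc sets and the external/internal order -/

theorem indep_of_mem_nbcComplex [M.Finite] {I : Set α} (hI : I ∈ (nbcComplex M).faces) :
    M.Indep I := by
  rw [Matroid.indep_iff_forall_subset_not_isCircuit hI.1]
  intro C hC hCc
  obtain ⟨e, he, hmax⟩ := exists_max_image C id (M.ground_finite.subset hCc.subset_ground)
    hCc.nonempty
  exact hI.2 (C \ {e}) ⟨C, e, hCc, ⟨he, hmax⟩, rfl⟩ (sdiff_subset.trans hC)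

theorem EA_eq_empty_of_mem_nbcComplex [M.Finite] {I : Set α} (hI : I ∈ (nbcComplex M).faces) :
    EA M I = ∅ := by
  refine eq_empty_of_forall_notMem ?_
  rintro e ⟨-, C, hC, hCI, hmax⟩
  exact hI.2 (C \ {e}) ⟨C, e, hC, hmax, rfl⟩ (sdiff_singleton_subset_iff.2 hCI)

/-- This is the only property of the order that the shelling needs. -/
theorem extIntLE_of_subset [M.Finite] {I J : Set α} (hI : I ∈ (nbcComplex M).faces)
    (hIJ : I ⊆ J) : ExtIntLE M I J := by
  by_cases h : InternallyRelated M I J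
  · exact Or.inr ⟨h, hIJ⟩
  · refine Or.inl ⟨h, ?_⟩
    rw [EA_eq_empty_of_mem_nbcComplex hI, union_empty]
    rintro x ⟨hxI, hx⟩
    exact Or.inl ⟨hIJ hxI, fun h => hx (mem_IA_of_subset hIJ hxI h)⟩

/-! ### The facets `G(I)` -/

theorem z_image_subset_nbcFacet {I J : Set α} : YZ.z '' J ⊆ nbcFacet M I ↔ J ⊆ I := by
  rw [image_subset_iff]
  exact forall₂_congr fun _ _ => z_mem_yz

theorem nbcFacet_injective (M : Matroid α) : Function.Injective (nbcFacet M) := by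
  intro I J h
  ext e
  have := Set.ext_iff.1 h (YZ.z e)
  simpa [nbcFacet] using this

theorem ncard_nbcFacet [M.Finite] {I : Set α} (hI : M.Indep I) :
    (nbcFacet M I).ncard = (relatedBase M I).ncard := by
  have h := relatedToBase_relatedBase hI
  have hfin : (relatedBase M I).Finite := M.ground_finite.subset h.1.subset_ground
  rw [nbcFacet, ncard_yz (hfin.subset sdiff_subset) (hfin.subset h.subset),
    ncard_sdiff_add_ncard_of_subset h.subset hfin]

theorem ncard_nbcFacet_eq [M.Finite] {I J : Set α} (hI : M.Indep I) (hJ : M.Indep J) :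
    (nbcFacet M I).ncard = (nbcFacet M J).ncard := by
  rw [ncard_nbcFacet hI, ncard_nbcFacet hJ]
  exact (relatedToBase_relatedBase hI).1.ncard_eq_ncard_of_isBase (relatedToBase_relatedBase hJ).1

theorem facets_augNbcComplex (M : Matroid α) [M.Finite] :
    (augNbcComplex M).facets = nbcFacet M '' (nbcComplex M).faces := by
  have hfin : ∀ A ∈ (augNbcComplex M).faces, A.Finite := fun A hA =>
    (augNbcComplex M).ground_finite.subset ((augNbcComplex M).subset_ground A hA)
  ext A
  constructor
  · rintro ⟨⟨F, hF, hAF⟩, hmax⟩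
    rwa [hAF.antisymm (hmax ⟨F, hF, Subset.rfl⟩ hAF)]
  · rintro ⟨I, hI, rfl⟩
    refine ⟨⟨_, ⟨I, hI, rfl⟩, Subset.rfl⟩, ?_⟩
    rintro A hA hIA
    obtain ⟨_, ⟨J, hJ, rfl⟩, hAJ⟩ := id hA
    have hJfin := hfin (nbcFacet M J) ⟨_, ⟨J, hJ, rfl⟩, Subset.rfl⟩
    -- All the sets `G(J)` have the size of a basis, so containment between two of them is equality.
    have := eq_of_subset_of_ncard_le (hIA.trans hAJ) (ncard_nbcFacet_eq
      (indep_of_mem_nbcComplex hJ) (indep_of_mem_nbcComplex hI)).le hJfin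
    exact this ▸ hAJ

theorem isPure_augNbcComplex (M : Matroid α) [M.Finite] : (augNbcComplex M).IsPure := by
  rw [FinComplex.IsPure, facets_augNbcComplex]
  rintro _ ⟨I, hI, rfl⟩ _ ⟨J, hJ, rfl⟩
  exact ncard_nbcFacet_eq (indep_of_mem_nbcComplex hI) (indep_of_mem_nbcComplex hJ)

/-- Deleting `e` from `I` keeps every `y`-vertex of `G(I)` and loses only `z_e` among its
`z`-vertices. -/
theorem nbcFacet_sdiff_singleton_inter [M.Finite] {I : Set α} (hI : M.Indep I) (e : α) :
    nbcFacet M (I \ {e}) ∩ nbcFacet M I = nbcFacet M I \ {YZ.z e} := by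
  have hsub := (relatedToBase_relatedBase hI).sdiff_subset_sdiff
    (relatedToBase_relatedBase (hI.subset (sdiff_subset (t := {e})))) sdiff_subset
  ext (x | x)
  · simp only [nbcFacet, mem_inter_iff, y_mem_yz, mem_sdiff (s := yz _ _), mem_singleton_iff,
      reduceCtorEq, not_false_eq_true, and_true]
    exact ⟨And.right, fun h => ⟨hsub h, h⟩⟩
  · simp only [nbcFacet, mem_inter_iff, z_mem_yz, mem_sdiff, mem_singleton_iff, YZ.z.injEq]
    tauto

/-! ### Linear extensions -/

namespace IsLinearExtension

variable [M.Finite] {s : ℕ} {I : Fin s → Set α}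

theorem mem_faces (hI : IsLinearExtension M I) (k : Fin s) : I k ∈ (nbcComplex M).faces :=
  hI.range_eq ▸ mem_range_self k

theorem indep (hI : IsLinearExtension M I) (k : Fin s) : M.Indep (I k) :=
  indep_of_mem_nbcComplex (hI.mem_faces k)

theorem le_of_subset (hI : IsLinearExtension M I) {i k : Fin s} (h : I i ⊆ I k) : i ≤ k :=
  hI.monotone i k (extIntLE_of_subset (hI.mem_faces i) h)

theorem exists_lt_eq_sdiff (hI : IsLinearExtension M I) {k : Fin s} {e : α} (he : e ∈ I k) :
    ∃ j, j < k ∧ I j = I k \ {e} := by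
  have hmem : I k \ {e} ∈ range I :=
    hI.range_eq ▸ (nbcComplex M).down_closed _ (hI.mem_faces k) _ sdiff_subset
  obtain ⟨j, hj⟩ := hmem
  refine ⟨j, lt_of_le_of_ne (hI.le_of_subset (hj ▸ sdiff_subset)) ?_, hj⟩
  rintro rfl
  rw [hj] at he
  exact he.2 rfl

theorem isShelling (hI : IsLinearExtension M I) :
    (augNbcComplex M).IsShelling (fun i => nbcFacet M (I i)) where
  pure := isPure_augNbcComplex M
  injective := (nbcFacet_injective M).comp hI.injective
  range_eq := by
    rw [facets_augNbcComplex, ← hI.range_eq, ← range_comp, Function.comp_def]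
  shelling := by
    intro i k hik
    obtain ⟨e, hek, hei⟩ := not_subset.1 fun h => (hI.le_of_subset h).not_gt hik
    obtain ⟨j, hjk, hj⟩ := hI.exists_lt_eq_sdiff hek
    have heq := nbcFacet_sdiff_singleton_inter (hI.indep k) e
    refine ⟨j, hjk, YZ.z e, z_mem_yz.2 hek, ?_, ?_⟩
    · simp only [hj, heq]
      rintro x ⟨hxi, hxk⟩
      refine ⟨hxk, ?_⟩
      rintro rfl
      exact hei (z_mem_yz.1 hxi)
    · simp only [hj, heq]

theorem restrictionSet_eq (hI : IsLinearExtension M I) (k : Fin s) :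
    restrictionSet (fun i => nbcFacet M (I i)) k = YZ.z '' I k := by
  -- The set `z_{I_k}` is itself a new face, since lying in an earlier facet would force `I_k ⊆
  -- I_i`. Conversely, a face of `G(I_k)` missing `z_e` already lies in `G(I_k \ {e})`.
  refine Subset.antisymm (sInter_subset_of_mem ⟨z_image_subset_nbcFacet.2 Subset.rfl, ?_⟩) ?_
  · exact fun i hik h => (hI.le_of_subset (z_image_subset_nbcFacet.1 h)).not_gt hik
  · refine subset_sInter ?_
    rintro A ⟨hAk, hA⟩ _ ⟨e, he, rfl⟩
    by_contra heA
    obtain ⟨j, hjk, hj⟩ := hI.exists_lt_eq_sdiff he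
    refine hA j hjk fun x hx => ?_
    have hx' : x ∈ nbcFacet M (I k) \ {YZ.z e} := ⟨hAk hx, fun h => heA (h ▸ hx)⟩
    rw [← nbcFacet_sdiff_singleton_inter (hI.indep k) e, ← hj] at hx'
    exact hx'.1

theorem propertyH (hI : IsLinearExtension M I) : PropertyH (fun i => nbcFacet M (I i)) := by
  rintro G i j x ⟨-, hGi⟩ - hxG hx
  rw [hI.restrictionSet_eq] at hx ⊢
  obtain ⟨e, -, rfl⟩ := hx
  exact mem_image_of_mem _ (z_mem_yz.1 (hGi hxG))

theorem hasHComplex (hI : IsLinearExtension M I) :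
    HasHComplex (fun i => nbcFacet M (I i)) ((nbcComplex M).map YZ.z) := by
  change range _ = image YZ.z '' (nbcComplex M).faces
  rw [← hI.range_eq, ← range_comp]
  exact congrArg range (funext hI.restrictionSet_eq)

end IsLinearExtension

end Activities

end AugNbc

theorem mainTheorem6 {α : Type*} [LinearOrder α] (M : Matroid α) [M.Finite]
    {s : ℕ} (I : Fin s → Set α) (hI : AugNbc.IsLinearExtension M I) :
    AugNbc.IsHShelling (AugNbc.augNbcComplex M) (fun i => AugNbc.nbcFacet M (I i)) ∧
      AugNbc.HasHComplex (fun i => AugNbc.nbcFacet M (I i))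
        ((AugNbc.nbcComplex M).map AugNbc.YZ.z) :=
  ⟨⟨hI.isShelling, hI.propertyH⟩, hI.hasHComplex⟩
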